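/- Let $n,k$ be integers with $1\le k<n$, let $s\in(1/2,1)$, and write points of $\mathbb{R}^n$ as $x=(y,z)$ with $y\in\mathbb{R}^k$, $z\in\mathbb{R}^{n-k}$. Let $\mathcal{K}_k^s$ be the set of measurable kernels $K:\mathbb{R}^n\to[0,\infty)$ such that for all $z\in\mathbb{R}^{n-k}$ and all $r>0$ the set $\{y\in\mathbb{R}^k: K(y,z)>r^{-n-2s}\}$ has the same $k$-dimensional measure as the ball of radius $(r^2-|z|^2)^{1/2}$ in $\mathbb{R}^k$ if $|z|<r$, and measure $0$ if $|z|\ge r$. Let $$\mathcal{F}_k^s u(x_0)=c_{n,s}\inf_{K\in\mathcal{K}_k^s}\int_{\mathbb{R}^n}\big(u(x_0+x)-u(x_0)-x\cdot\nabla u(x_0)\big)K(x)\,dx,$$ where $c_{n,s}=\dfrac{4^s\,s\,\Gamma(n/2+s)}{\pi^{n/2}\,\Gamma(1-s)}$ is the constant in the fractional Laplacian $\Delta^s=-(-\Delta)^s$; for convex $u$ the integrals, and $\mathcal{F}_k^su(x_0)$, take values in $[0,\infty]$. For $t>0$ let $$D_{x_0}u(t)=\{x\in\mathbb{R}^n: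 u(x)-u(x_0)-(x-x_0)\cdot\nabla u(x_0)\le t\}.$$ Let $[u]_{C^{1,1}(x_0)}$ be the infimum of the constants $C>0$ for which there are $p\in\mathbb{R}^n$ and $\rho>0$ with $|u(x_0+x)-u(x_0)-x\cdot p|\le C|x|^2$ for all $x\in B_\rho$ ($\infty$ if there is no such $C$), and let $[u]_{C^{1,1}(\mathbb{R}^n)}=\sup_{x_0\in\mathbb{R}^n}[u]_{C^{1,1}(x_0)}$. **Proposition 5.2.** There is a constant $C>0$ depending only on $n$, $k$ and $s$ such that the following holds. Let $u:\mathbb{R}^n\to\mathbb{R}$ be convex with $[u]_{C^{1,1}(\mathbb{R}^n)}\le 1$, let $x_0\in\mathbb{R}^n$ and $\varepsilon>0$, and suppose that $\Lambda=\operatorname{diam}(D_{x_0}u(\varepsilon))<\infty$. Then for every $r\le\varepsilon/(4\Lambda)$ and every $x_1\in B_r(x_0)$, $$\mathcal{F}_k^su(x_1)\le\mathcal{F}_k^su(x_0)+C\Lambda^{1-s}|x_1-x_0|^{1-s}+\frac{4\Lambda}{\varepsilon}|x_1-x_0|\,\mathcal{F}_k^su(x_0)\quad\text{in }[0,\infty].$$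 In particular, if $\mathcal{F}_k^su(x_0)<\infty$, then $\mathcal{F}_k^su(x_1)<\infty$ and $$\mathcal{F}_k^su(x_1)-\mathcal{F}_k^su(x_0)\le C\Lambda^{1-s}|x_1-x_0|^{1-s}+\frac{4\Lambda}{\varepsilon}|x_1-x_0|\,\mathcal{F}_k^su(x_0).$$ -/

import Mathlib

open MeasureTheory Set
open scoped ENNReal NNReal

noncomputable section

namespace FracHessian

/-- The point `x = (y, z)` of `ℝⁿ` whose first `k` coordinates are those of `y ∈ ℝᵏ` and whose
last `n - k` coordinates are those of `z ∈ ℝⁿ⁻ᵏ`. -/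
def joinCoords (n k : ℕ) (y : EuclideanSpace ℝ (Fin k)) (z : EuclideanSpace ℝ (Fin (n - k))) :
    EuclideanSpace ℝ (Fin n) :=
  WithLp.toLp 2 fun i : Fin n =>
    if h : (i : ℕ) < k then y ⟨i, h⟩ else z ⟨(i : ℕ) - k, by omega⟩

/-- The family `𝒦ₖˢ` of admissible kernels: measurable `K : ℝⁿ → [0, ∞)` such that, for every
`z ∈ ℝⁿ⁻ᵏ` and `r > 0`, the set `{y ∈ ℝᵏ : K(y, z) > r^(-n-2s)}` has the `k`-dimensional measure
of the ball of radius `(r² - |z|²)^(1/2)` of `ℝᵏ` if `|z| < r`, and measure `0` if `|z| ≥ r`. -/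
def kernels (n k : ℕ) (s : ℝ) : Set (EuclideanSpace ℝ (Fin n) → ℝ) :=
  {K | Measurable K ∧ (∀ x, 0 ≤ K x) ∧
    ∀ (z : EuclideanSpace ℝ (Fin (n - k))) (r : ℝ), 0 < r →
      volume {y : EuclideanSpace ℝ (Fin k) | r ^ (-(n : ℝ) - 2 * s) < K (joinCoords n k y z)} =
        if ‖z‖ < r then
          volume (Metric.ball (0 : EuclideanSpace ℝ (Fin k)) (Real.sqrt (r ^ 2 - ‖z‖ ^ 2)))
        else 0}

/-- `ũ(x) = u(x₀ + x) - u(x₀) - x · ∇u(x₀)`. -/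
def tilde {n : ℕ} (u : EuclideanSpace ℝ (Fin n) → ℝ) (x₀ x : EuclideanSpace ℝ (Fin n)) : ℝ :=
  u (x₀ + x) - u x₀ - inner ℝ x (gradient u x₀)

/-- The integral of a real function over `ℝⁿ` with values in `[-∞, ∞]`: the integral of the
positive part minus the integral of the negative part. (For `f ≥ 0` it is `∫ f ∈ [0, ∞]`.) -/
def eIntegral {n : ℕ} (f : EuclideanSpace ℝ (Fin n) → ℝ) : EReal :=
  ((∫⁻ x, ENNReal.ofReal (f x) : ℝ≥0∞) : EReal) -
    ((∫⁻ x, ENNReal.ofReal (-f x) : ℝ≥0∞) : EReal)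

/-- The normalising constant of the fractional Laplacian `Δˢ = -(-Δ)ˢ` on `ℝⁿ`,
`c_{n,s} = 4ˢ s Γ(n/2 + s) / (π^(n/2) Γ(1 - s))`. -/
def fracLapConst (n : ℕ) (s : ℝ) : ℝ :=
  4 ^ s * s * Real.Gamma ((n : ℝ) / 2 + s) / (Real.pi ^ ((n : ℝ) / 2) * Real.Gamma (1 - s))

/-- The operator `ℱₖˢ u(x₀) = c_{n,s} inf_{K ∈ 𝒦ₖˢ} ∫ ũ(x) K(x) dx`, with values in `[-∞, ∞]`. -/
def operatorF (n k : ℕ) (s : ℝ) (u : EuclideanSpace ℝ (Fin n) → ℝ)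
    (x₀ : EuclideanSpace ℝ (Fin n)) : EReal :=
  ((fracLapConst n s : ℝ) : EReal) *
    ⨅ K ∈ kernels n k s, eIntegral fun x => tilde u x₀ x * K x

/-- `[u]_{C^{1,1}(x₀)}`: the least constant `C` such that, for some vector `p` and radius `ρ > 0`,
`|u(x₀ + x) - u(x₀) - x · p| ≤ C |x|²` for all `x ∈ B_ρ`. It is `∞` if `u` is not `C^{1,1}` at
`x₀`. -/
def c11SeminormAt {n : ℕ} (u : EuclideanSpace ℝ (Fin n) → ℝ)
    (x₀ : EuclideanSpace ℝ (Fin n)) : ℝ≥0∞ :=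
  ⨅ (C : ℝ≥0) (_ : 0 < C ∧ ∃ (p : EuclideanSpace ℝ (Fin n)) (ρ : ℝ), 0 < ρ ∧
    ∀ x ∈ Metric.ball (0 : EuclideanSpace ℝ (Fin n)) ρ,
      |u (x₀ + x) - u x₀ - inner ℝ x p| ≤ C * ‖x‖ ^ 2), (C : ℝ≥0∞)

/-- `[u]_{C^{1,1}(ℝⁿ)}`, the supremum of `[u]_{C^{1,1}(x₀)}` over all points `x₀`. -/
def c11Seminorm {n : ℕ} (u : EuclideanSpace ℝ (Fin n) → ℝ) : ℝ≥0∞ :=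
  ⨆ x₀, c11SeminormAt u x₀

/-- The section `D_{x₀} u(t) = {x : u(x) - u(x₀) - (x - x₀) · ∇u(x₀) ≤ t}`. -/
def sectionSet {n : ℕ} (u : EuclideanSpace ℝ (Fin n) → ℝ) (x₀ : EuclideanSpace ℝ (Fin n))
    (t : ℝ) : Set (EuclideanSpace ℝ (Fin n)) :=
  {x | u x - u x₀ - inner ℝ (x - x₀) (gradient u x₀) ≤ t}

end FracHessian

end

/-! Write d = |x₁ - x₀|, p = -n-2s and ρ = √(dΛ). From any competitor K at x₀ one builds a
competitor K' at x₁ whose integral is controlled by that of K; comparing infima then suffices, and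
no minimiser is needed.

By `exists_kernel_eq_rpow_on_ball`, K' can be |x|^p in B_ρ and at most min(K, ρ^p) outside. Inside,
ũ ≤ |x|² (`tilde_le_norm_sq`) yields a multiple of ρ^(2-2s) = (dΛ)^(1-s). Outside, the gradient is
2-Lipschitz, so moving the base point costs at most 4d|x| (`tilde_le_tilde_add`), and convexity
gives |x| ≤ Λ + (Λ/ε)ũ (`norm_le_diam_add`), with ũ taken at x₀. The constant 4dΛ is integrated
against min(K, ρ^p), whose mass is at most a multiple of ρ^(-2s) (`lintegral_min_kernel_le`): again
(dΛ)^(1-s). What remains is (1 + 4Λd/ε)∫ũK.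

The kernel surgery works because on every slice {K > ρ^p} and B_ρ have equal finite measure, hence
so do their two differences. The low values of K displaced from B_ρ are moved, equimeasurably and
measurably in z, to the points outside B_ρ where K > ρ^p (`exists_equimeasurable_transfer`); K only
decreases there. -/

open Filter Topology

/-! ### Convex functions with a quadratic upper bound -/

section Convex

variable {E : Type*} [NormedAddCommGroup E] [InnerProductSpace ℝ E] [CompleteSpace E]

/-- Along the line `t ↦ x + t • h`, a function with a gradient has the expected derivative. -/
theorem HasGradientAt.hasDerivAt_line {u : E → ℝ} {g x h : E} {t : ℝ}
    (hu : HasGradientAt u g (x + t • h)) :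
    HasDerivAt (fun t : ℝ => u (x + t • h)) (inner ℝ h g) t := by
  have h1 : HasDerivAt (fun t : ℝ => x + t • h) h t := by
    simpa using ((hasDerivAt_id t).smul_const h).const_add x
  have h2 : HasDerivAt (fun t : ℝ => u (x + t • h)) (InnerProductSpace.toDual ℝ E g h) t :=
    hu.hasFDerivAt.comp_hasDerivAt t h1
  rwa [InnerProductSpace.toDual_apply_apply, real_inner_comm] at h2

/-- The tangent plane of a convex function lies below its graph. -/
theorem ConvexOn.add_inner_gradient_le {u : E → ℝ} (hc : ConvexOn ℝ univ u) {g x : E}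
    (hu : HasGradientAt u g x) (h : E) : 0 ≤ u (x + h) - u x - inner ℝ h g := by
  have hline : ConvexOn ℝ univ (fun t : ℝ => u (x + t • h)) := by
    refine ⟨convex_univ, fun a _ b _ p q hp hq hpq => ?_⟩
    have e : x + (p • a + q • b) • h = p • (x + a • h) + q • (x + b • h) := by
      obtain rfl : q = 1 - p := by linarith
      module
    simp only [e]
    exact hc.2 (mem_univ _) (mem_univ _) hp hq hpq
  have hd : HasDerivAt (fun t : ℝ => u (x + t • h)) (inner ℝ h g) 0 :=
    HasGradientAt.hasDerivAt_line (by simpa using hu)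
  have := hline.le_slope_of_hasDerivAt (mem_univ 0) (mem_univ 1) one_pos hd
  simp [slope_def_field] at this
  linarith

/-- A differentiable function which, near every point, lies below its tangent plane plus
`C |h|²`, does so globally, with any larger constant. -/
theorem le_quadratic_of_eventually_le {u : E → ℝ} {G : E → E}
    (hG : ∀ x, HasGradientAt u (G x) x) {C C' : ℝ} (hC : C < C')
    (hloc : ∀ x, ∀ᶠ h in 𝓝 (0 : E), u (x + h) - u x - inner ℝ h (G x) ≤ C * ‖h‖ ^ 2)
    (x h : E) : u (x + h) - u x - inner ℝ h (G x) ≤ C' * ‖h‖ ^ 2 := by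
  by_contra! hlt
  have hh : h ≠ 0 := by
    rintro rfl
    simp at hlt
  -- The slope m makes ψ vanish at both ends, while the negated claim says exactly ψ'(0) < 0. So ψ
  -- has an interior minimum, where u bends upwards by at least C'|h|²τ², contradicting the local
  -- bound with C < C'.
  set m : ℝ := u (x + h) - u x - C' * ‖h‖ ^ 2 with hm
  set ψ : ℝ → ℝ := fun t => u (x + t • h) - u x - C' * ‖h‖ ^ 2 * t ^ 2 - m * t with hψ
  have hψd : ∀ t, HasDerivAt ψ (inner ℝ h (G (x + t • h)) - C' * ‖h‖ ^ 2 * (2 * t) - m) t := by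
    intro t
    have h1 := HasGradientAt.hasDerivAt_line (hG (x + t • h))
    have h2 : HasDerivAt (fun t : ℝ => C' * ‖h‖ ^ 2 * t ^ 2) (C' * ‖h‖ ^ 2 * (2 * t)) t := by
      simpa using (hasDerivAt_pow 2 t).const_mul (C' * ‖h‖ ^ 2)
    have h3 : HasDerivAt (fun t : ℝ => m * t) m t := by
      simpa using (hasDerivAt_id t).const_mul m
    exact ((h1.sub_const (u x)).sub h2).sub h3
  have hψ0 : ψ 0 = 0 := by simp [hψ]
  have hψ1 : ψ 1 = 0 := by simp [hψ, hm]
  have hcont : ContinuousOn ψ (Icc 0 1) := fun t _ => (hψd t).continuousAt.continuousWithinAt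
  obtain ⟨t₀, ht₀, hmin⟩ := isCompact_Icc.exists_isMinOn (nonempty_Icc.2 zero_le_one) hcont
  -- the minimum is negative
  have hneg : ∃ t ∈ Icc (0 : ℝ) 1, ψ t < 0 := by
    have hd0 := hψd 0
    have hev : ∀ᶠ t in 𝓝[>] (0 : ℝ), slope ψ 0 t < 0 := by
      have := (hasDerivAt_iff_tendsto_slope.1 hd0).mono_left
        (nhdsWithin_mono 0 (fun t (ht : 0 < t) => ht.ne'))
      refine this.eventually_lt_const ?_
      simp only [zero_smul, add_zero, mul_zero, sub_zero]
      linarith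
    have h01 : ∀ᶠ t in 𝓝[>] (0 : ℝ), t ∈ Ioo (0 : ℝ) 1 := Ioo_mem_nhdsGT one_pos
    obtain ⟨t, ht, ht'⟩ := (hev.and h01).exists
    refine ⟨t, Ioo_subset_Icc_self ht', ?_⟩
    rw [slope_def_field, hψ0] at ht
    simp only [sub_zero] at ht
    exact (div_neg_iff.1 ht).resolve_left (fun h => by linarith [ht'.1, h.2]) |>.1
  obtain ⟨t₁, ht₁, hlt₁⟩ := hneg
  have hval : ψ t₀ < 0 := (hmin ht₁).trans_lt hlt₁
  have h0 : t₀ ≠ 0 := by rintro rfl; linarith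
  have h1 : t₀ ≠ 1 := by rintro rfl; linarith
  have hIoo : t₀ ∈ Ioo (0 : ℝ) 1 := ⟨lt_of_le_of_ne ht₀.1 h0.symm, lt_of_le_of_ne ht₀.2 h1⟩
  have hlm : IsLocalMin ψ t₀ := hmin.isLocalMin (Icc_mem_nhds hIoo.1 hIoo.2)
  have hder := hlm.hasDerivAt_eq_zero (hψd t₀)
  -- but near `t₀` the function lies strictly below its tangent
  have hev : ∀ᶠ τ in 𝓝 (0 : ℝ), u (x + t₀ • h + τ • h) - u (x + t₀ • h)
      - inner ℝ (τ • h) (G (x + t₀ • h)) ≤ C * ‖τ • h‖ ^ 2 := by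
    have : Tendsto (fun τ : ℝ => τ • h) (𝓝 0) (𝓝 0) := by
      have : Continuous fun τ : ℝ => τ • h := by fun_prop
      simpa using this.tendsto 0
    exact this.eventually (hloc _)
  have hev2 : ∀ᶠ τ in 𝓝 (0 : ℝ), ψ t₀ ≤ ψ (t₀ + τ) := by
    have : Tendsto (fun τ : ℝ => t₀ + τ) (𝓝 0) (𝓝 t₀) := by
      have : Continuous fun τ : ℝ => t₀ + τ := by fun_prop
      simpa using this.tendsto 0
    exact this.eventually hlm
  obtain ⟨τ, ⟨hτ1, hτ2⟩, hτ⟩ :=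
    (((hev.and hev2).filter_mono nhdsWithin_le_nhds).and
      (self_mem_nhdsWithin : Ioi (0 : ℝ) ∈ 𝓝[>] 0)).exists
  have hτ : 0 < τ := hτ
  have hn : 0 < ‖h‖ ^ 2 := by positivity
  rw [norm_smul, real_inner_smul_left, mul_pow, Real.norm_eq_abs, sq_abs] at hτ1
  have e : x + t₀ • h + τ • h = x + (t₀ + τ) • h := by rw [add_smul, add_assoc]
  rw [e] at hτ1
  simp only [hψ] at hτ2
  have hI : inner ℝ h (G (x + t₀ • h)) = C' * ‖h‖ ^ 2 * (2 * t₀) + m := by linarith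
  rw [hI] at hτ1
  have : 0 < (C' - C) * (τ ^ 2 * ‖h‖ ^ 2) := mul_pos (by linarith) (by positivity)
  nlinarith

/-- A convex function lying below its tangent planes plus `|h|²` has a `2`-Lipschitz gradient. -/
theorem ConvexOn.norm_gradient_sub_le {u : E → ℝ} (hc : ConvexOn ℝ univ u) {G : E → E}
    (hG : ∀ x, HasGradientAt u (G x) x)
    (hq : ∀ x h, u (x + h) - u x - inner ℝ h (G x) ≤ ‖h‖ ^ 2) (x y : E) :
    ‖G x - G y‖ ≤ 2 * ‖x - y‖ := by
  -- At the point y - τg, the tangent plane at x bounds u below and the quadratic at y bounds it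
  -- above; τ = 1/2 maximises the gain (τ - τ²)|g|². Adding the estimate to its mirror image gives
  -- |g|²/2 ≤ ⟨y - x, g⟩.
  have key : ∀ x y, ‖G y - G x‖ ^ 2 / 4 ≤ u y - u x - inner ℝ (y - x) (G x) := by
    intro x y
    set g := G y - G x with hg
    have h1 := hc.add_inner_gradient_le (hG x) (y - x - (1 / 2 : ℝ) • g)
    have h2 := hq y (-((1 / 2 : ℝ) • g))
    have e : x + (y - x - (1 / 2 : ℝ) • g) = y + -((1 / 2 : ℝ) • g) := by abel
    rw [e, inner_sub_left] at h1
    rw [norm_neg, norm_smul, inner_neg_left, mul_pow] at h2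
    have e2 : inner ℝ ((1 / 2 : ℝ) • g) (G y) - inner ℝ ((1 / 2 : ℝ) • g) (G x)
        = 1 / 2 * ‖g‖ ^ 2 := by
      rw [← inner_sub_right, ← hg, real_inner_smul_left, real_inner_self_eq_norm_sq]
    norm_num at h2 e2
    linarith
  have h1 := key x y
  have h2 := key y x
  rw [norm_sub_rev (G x) (G y)] at h2 ⊢
  have e : inner ℝ (y - x) (G x) + inner ℝ (x - y) (G y) = - inner ℝ (y - x) (G y - G x) := by
    rw [inner_sub_right, ← neg_sub y x, inner_neg_left]; ring
  have h3 : inner ℝ (y - x) (G y - G x) ≤ ‖y - x‖ * ‖G y - G x‖ := real_inner_le_norm _ _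
  rw [norm_sub_rev x y]
  by_contra! hlt
  have hp : 0 < ‖G y - G x‖ := lt_of_le_of_lt (by positivity) hlt
  nlinarith

/-- Moving the base point by `h` changes the second order increment at `x` by at most
`4 |h| |x|`. -/
theorem second_increment_le {u : E → ℝ} {G : E → E} (hG : ∀ x, HasGradientAt u (G x) x)
    (hL : ∀ x y, ‖G x - G y‖ ≤ 2 * ‖x - y‖) (x₀ x₁ x : E) :
    u (x₁ + x) - u x₁ - inner ℝ x (G x₁) ≤
      u (x₀ + x) - u x₀ - inner ℝ x (G x₀) + 4 * ‖x₁ - x₀‖ * ‖x‖ := by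
  set h := x₁ - x₀ with hh
  -- The factor 4 is 2 + 2: one 2|h||x| bounds the variation of φ, the other the change of the
  -- linear term.
  set φ : ℝ → ℝ := fun t => u (x₀ + x + t • h) - u (x₀ + t • h) with hφ
  have hd : ∀ t, HasDerivAt φ (inner ℝ h (G (x₀ + x + t • h)) - inner ℝ h (G (x₀ + t • h))) t :=
    fun t => (HasGradientAt.hasDerivAt_line (hG _)).sub (HasGradientAt.hasDerivAt_line (hG _))
  have hb : ∀ t ∈ Icc (0 : ℝ) 1,
      ‖inner ℝ h (G (x₀ + x + t • h)) - inner ℝ h (G (x₀ + t • h))‖ ≤ 2 * ‖h‖ * ‖x‖ := by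
    intro t _
    rw [← inner_sub_right]
    refine (norm_inner_le_norm _ _).trans ?_
    have := hL (x₀ + x + t • h) (x₀ + t • h)
    have e : x₀ + x + t • h - (x₀ + t • h) = x := by abel
    rw [e] at this
    nlinarith [norm_nonneg h]
  have h1 := (convex_Icc (0 : ℝ) 1).norm_image_sub_le_of_norm_hasDerivWithin_le
    (fun t _ => (hd t).hasDerivWithinAt) hb (left_mem_Icc.2 zero_le_one)
    (right_mem_Icc.2 zero_le_one)
  simp only [sub_zero, norm_one, mul_one] at h1
  have h2 := (le_abs_self _).trans h1
  have e1 : x₀ + x + h = x₁ + x := by rw [hh]; abel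
  have e2 : x₀ + h = x₁ := by rw [hh]; abel
  simp only [hφ, one_smul, zero_smul, add_zero, e1, e2] at h2
  have h3 : -inner ℝ x (G x₁ - G x₀) ≤ ‖x‖ * (2 * ‖h‖) :=
    (neg_le_abs _).trans ((abs_real_inner_le_norm _ _).trans
      (mul_le_mul_of_nonneg_left (hL _ _) (norm_nonneg _)))
  rw [inner_sub_right] at h3
  linarith

end Convex

/-! ### Pointwise estimates for `tilde` -/

namespace FracHessian

variable {n : ℕ}

/-- A function with finite pointwise `C^{1,1}` seminorm is differentiable at the point, with a
one-sided quadratic bound for every constant larger than the seminorm. -/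
theorem eventually_le_of_c11SeminormAt {u : EuclideanSpace ℝ (Fin n) → ℝ}
    {x₀ : EuclideanSpace ℝ (Fin n)} {C : ℝ≥0} (h : c11SeminormAt u x₀ < C) :
    HasGradientAt u (gradient u x₀) x₀ ∧
      ∀ᶠ x in 𝓝 (0 : EuclideanSpace ℝ (Fin n)),
        u (x₀ + x) - u x₀ - inner ℝ x (gradient u x₀) ≤ C * ‖x‖ ^ 2 := by
  simp only [c11SeminormAt, iInf_lt_iff] at h
  obtain ⟨C', ⟨hC', p, ρ, hρ, hp⟩, hlt⟩ := h
  have hev : ∀ᶠ x in 𝓝 (0 : EuclideanSpace ℝ (Fin n)),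
      |u (x₀ + x) - u x₀ - inner ℝ x p| ≤ C' * ‖x‖ ^ 2 :=
    Filter.mem_of_superset (Metric.ball_mem_nhds 0 hρ) hp
  -- A quadratic remainder is o(|x|), so the unspecified slope p can only be the gradient.
  have hgr : HasGradientAt u p x₀ := by
    rw [hasGradientAt_iff_isLittleO_nhds_zero]
    have h1 : (fun x : EuclideanSpace ℝ (Fin n) => u (x₀ + x) - u x₀ - inner ℝ p x)
        =O[𝓝 0] fun x => ‖x‖ ^ 2 := by
      refine Asymptotics.IsBigO.of_bound C' (hev.mono fun x hx => ?_)
      rw [real_inner_comm, Real.norm_eq_abs, norm_pow, norm_norm]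
      exact hx
    refine h1.trans_isLittleO ?_
    exact Asymptotics.isLittleO_norm_pow_id one_lt_two
  rw [hgr.gradient]
  refine ⟨hgr, hev.mono fun x hx => (le_abs_self _).trans (hx.trans ?_)⟩
  have : (C' : ℝ) ≤ C := by exact_mod_cast (ENNReal.coe_lt_coe.1 hlt).le
  gcongr

section

variable {u : EuclideanSpace ℝ (Fin n) → ℝ}

theorem hasGradientAt_of_c11Seminorm_le_one (h : c11Seminorm u ≤ 1)
    (x : EuclideanSpace ℝ (Fin n)) : HasGradientAt u (gradient u x) x :=
  (eventually_le_of_c11SeminormAt (C := 2)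
    (((le_iSup _ x).trans h).trans_lt (by norm_num))).1

/-- The infimum defining the seminorm need not be attained, and passing from local to global costs a
little more. Both losses fit below any C > 1, and C tends to 1 at the end. -/
theorem tilde_le_norm_sq (h : c11Seminorm u ≤ 1) (x₀ x : EuclideanSpace ℝ (Fin n)) :
    tilde u x₀ x ≤ ‖x‖ ^ 2 := by
  have key : ∀ C : ℝ, 1 < C → tilde u x₀ x ≤ C * ‖x‖ ^ 2 := by
    intro C hC
    obtain ⟨C₁, hC₁, hC₁'⟩ := exists_between hC
    refine le_quadratic_of_eventually_le (hasGradientAt_of_c11Seminorm_le_one h) hC₁'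
      (fun y => ?_) x₀ x
    have h1 : c11SeminormAt u y < (C₁.toNNReal : ℝ≥0) := by
      refine ((le_iSup _ y).trans h).trans_lt ?_
      exact_mod_cast Real.one_lt_toNNReal.2 hC₁
    simpa [Real.coe_toNNReal C₁ (by linarith)] using (eventually_le_of_c11SeminormAt h1).2
  by_contra! hlt
  rcases (sq_nonneg ‖x‖).eq_or_lt with h0 | h0
  · have := key 2 one_lt_two
    rw [← h0] at this hlt
    linarith
  -- The midpoint between 1 and the ratio ũ/|x|² > 1 is an admissible constant smaller than the
  -- ratio.
  · have := key ((1 + tilde u x₀ x / ‖x‖ ^ 2) / 2)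
      (by have := (one_lt_div h0).2 hlt; linarith)
    have e : tilde u x₀ x / ‖x‖ ^ 2 * ‖x‖ ^ 2 = tilde u x₀ x := div_mul_cancel₀ _ h0.ne'
    nlinarith

theorem tilde_nonneg (hc : ConvexOn ℝ univ u) (h : c11Seminorm u ≤ 1)
    (x₀ x : EuclideanSpace ℝ (Fin n)) : 0 ≤ tilde u x₀ x :=
  hc.add_inner_gradient_le (hasGradientAt_of_c11Seminorm_le_one h x₀) x

theorem tilde_le_tilde_add (hc : ConvexOn ℝ univ u) (h : c11Seminorm u ≤ 1)
    (x₀ x₁ x : EuclideanSpace ℝ (Fin n)) :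
    tilde u x₁ x ≤ tilde u x₀ x + 4 * ‖x₁ - x₀‖ * ‖x‖ :=
  second_increment_le (hasGradientAt_of_c11Seminorm_le_one h)
    (hc.norm_gradient_sub_le (hasGradientAt_of_c11Seminorm_le_one h) (tilde_le_norm_sq h)) x₀ x₁ x

theorem measurable_tilde (h : c11Seminorm u ≤ 1) (x₀ : EuclideanSpace ℝ (Fin n)) :
    Measurable (tilde u x₀) := by
  have hu : Continuous u := continuous_iff_continuousAt.2 fun x =>
    (hasGradientAt_of_c11Seminorm_le_one h x).hasFDerivAt.continuousAt
  have : Continuous (tilde u x₀) := by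
    unfold tilde
    fun_prop
  exact this.measurable

/-- Outside a bounded section, `ũ` grows at least linearly. -/
theorem norm_le_diam_add (hc : ConvexOn ℝ univ u) (h : c11Seminorm u ≤ 1)
    {x₀ : EuclideanSpace ℝ (Fin n)} {ε : ℝ} (hε : 0 < ε)
    (hb : Bornology.IsBounded (sectionSet u x₀ ε)) (x : EuclideanSpace ℝ (Fin n)) :
    ‖x‖ ≤ Metric.diam (sectionSet u x₀ ε) +
      Metric.diam (sectionSet u x₀ ε) / ε * tilde u x₀ x := by
  set Λ := Metric.diam (sectionSet u x₀ ε)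
  have hΛ : 0 ≤ Λ := Metric.diam_nonneg
  have hmem : ∀ y, tilde u x₀ y ≤ ε → ‖y‖ ≤ Λ := by
    intro y hy
    have h1 : x₀ + y ∈ sectionSet u x₀ ε := by
      simpa [sectionSet, tilde] using hy
    have h2 : x₀ ∈ sectionSet u x₀ ε := by simpa [sectionSet] using hε.le
    simpa using Metric.dist_le_diam_of_mem hb h1 h2
  have h0 := tilde_nonneg hc h x₀ x
  rcases le_or_gt (tilde u x₀ x) ε with hx | hx
  · have := hmem x hx
    have : 0 ≤ Λ / ε * tilde u x₀ x := by positivity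
    linarith
  · have hT : 0 < tilde u x₀ x := hε.trans hx
    -- Shrinking x by t brings it into the section: by convexity ũ(tx) ≤ tũ(x) = ε, so t|x| ≤ Λ.
    set t := ε / tilde u x₀ x with ht
    have ht0 : 0 < t := by positivity
    have ht1 : t ≤ 1 := ((div_lt_one hT).2 hx).le
    have h1 : tilde u x₀ (t • x) ≤ t * tilde u x₀ x := by
      have := hc.2 (mem_univ x₀) (mem_univ (x₀ + x)) (sub_nonneg.2 ht1) ht0.le (by ring)
      have e : (1 - t) • x₀ + t • (x₀ + x) = x₀ + t • x := by module
      rw [e] at this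
      simp only [smul_eq_mul] at this
      simp only [tilde, real_inner_smul_left]
      linarith
    have h2 : t * tilde u x₀ x = ε := div_mul_cancel₀ _ hT.ne'
    have h3 := hmem (t • x) (h1.trans h2.le)
    rw [norm_smul, Real.norm_of_nonneg ht0.le] at h3
    have h4 : ‖x‖ ≤ Λ / t := by rw [le_div_iff₀ ht0]; linarith
    have h5 : Λ / t = Λ / ε * tilde u x₀ x := by rw [ht]; field_simp
    linarith

end

end FracHessian

/-! ### Equimeasurable transfer along slices -/

section Transfer

variable {Y : Type*} [NormedAddCommGroup Y] [NormedSpace ℝ Y] [FiniteDimensional ℝ Y]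
  [Nontrivial Y] [MeasurableSpace Y] [BorelSpace Y] (μ : Measure Y) [μ.IsAddHaarMeasure]

/-- A measurable set of finite measure, exhausted by the balls centred at the origin, contains a
part of any prescribed smaller measure, singled out by the measure swept by the balls. -/
theorem measure_swept_lt {E : Set Y} (hE : MeasurableSet E) (hfin : μ E ≠ ∞) {a : ℝ≥0∞}
    (ha : a ≤ μ E) : μ {y | y ∈ E ∧ μ (E ∩ Metric.ball 0 ‖y‖) < a} = a := by
  rcases eq_or_ne a 0 with rfl | ha0
  · simp
  set Γ : ℝ → ℝ≥0∞ := fun t => μ (E ∩ Metric.ball 0 t) with hΓ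
  have hmono : Monotone Γ := fun s t hst =>
    measure_mono (inter_subset_inter_right _ (Metric.ball_subset_ball hst))
  set S : Set ℝ := {t | a ≤ Γ t} with hS
  -- If the swept measure never reaches a, the set is all of E and a = μ E. Otherwise it is E cut by
  -- the ball of radius t₀ = inf S.
  rcases S.eq_empty_or_nonempty with hemp | hne
  · have hlt : ∀ t, Γ t < a := fun t => by
      by_contra! h
      exact (hemp ▸ (show t ∈ S from h) : t ∈ (∅ : Set ℝ))
    have hset : {y | y ∈ E ∧ μ (E ∩ Metric.ball 0 ‖y‖) < a} = E := by
      ext y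
      exact ⟨fun h => h.1, fun h => ⟨h, hlt _⟩⟩
    rw [hset]
    refine le_antisymm ?_ ha
    have hU : E = ⋃ n : ℕ, E ∩ Metric.ball 0 n := by
      rw [← inter_iUnion, Metric.iUnion_ball_nat, inter_univ]
    have hmonoU : Monotone fun n : ℕ => E ∩ Metric.ball (0 : Y) n := fun m n hmn =>
      inter_subset_inter_right _ (Metric.ball_subset_ball (by exact_mod_cast hmn))
    rw [hU, hmonoU.measure_iUnion]
    exact iSup_le fun n => (hlt n).le
  have hbdd : BddBelow S := by
    refine ⟨0, fun t ht => ?_⟩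
    by_contra! h
    have : Γ t = 0 := by simp [hΓ, Metric.ball_eq_empty.2 h.le]
    exact ha0 (le_antisymm (this ▸ ht) bot_le)
  set t₀ := sInf S with ht₀
  have hlow : ∀ t, t < t₀ → Γ t < a := fun t ht => by
    by_contra! h
    exact (not_le.2 ht) (csInf_le hbdd h)
  have hup : ∀ t, t₀ < t → a ≤ Γ t := fun t ht => by
    obtain ⟨t', ht', hlt⟩ := exists_lt_of_csInf_lt hne ht
    exact le_trans ht' (hmono hlt.le)
  have hle : Γ t₀ ≤ a := by
    have hU : E ∩ Metric.ball 0 t₀ = ⋃ n : ℕ, E ∩ Metric.ball (0 : Y) (t₀ - 1 / ((n : ℝ) + 1)) := by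
      rw [← inter_iUnion]
      congr 1
      ext y
      simp only [Metric.mem_ball, mem_iUnion]
      refine ⟨fun h => ?_, fun ⟨n, hn⟩ => hn.trans (sub_lt_self _ Nat.one_div_pos_of_nat)⟩
      obtain ⟨n, hn⟩ := exists_nat_one_div_lt (sub_pos.2 h)
      exact ⟨n, by linarith⟩
    have hmonoU : Monotone fun n : ℕ => E ∩ Metric.ball (0 : Y) (t₀ - 1 / ((n : ℝ) + 1)) :=
      fun m n hmn => inter_subset_inter_right _ (Metric.ball_subset_ball
        (sub_le_sub_left (Nat.one_div_le_one_div hmn) _))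
    simp only [hΓ]
    rw [hU, hmonoU.measure_iUnion]
    exact iSup_le fun n => (hlow _ (sub_lt_self _ Nat.one_div_pos_of_nat)).le
  -- Right continuity of Γ: spheres are null, and finiteness of μ E allows continuity from above.
  have hge : a ≤ Γ t₀ := by
    have h1 : Γ t₀ = μ (E ∩ Metric.closedBall 0 t₀) := by
      refine le_antisymm (measure_mono (inter_subset_inter_right _ Metric.ball_subset_closedBall)) ?_
      rw [← Metric.ball_union_sphere, inter_union_distrib_left]
      refine (measure_union_le _ _).trans ?_
      rw [measure_mono_null inter_subset_right (Measure.addHaar_sphere μ 0 t₀), add_zero]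
    have hI : E ∩ Metric.closedBall 0 t₀ =
        ⋂ n : ℕ, E ∩ Metric.ball (0 : Y) (t₀ + 1 / ((n : ℝ) + 1)) := by
      rw [← inter_iInter]
      congr 1
      ext y
      simp only [Metric.mem_ball, Metric.mem_closedBall, mem_iInter]
      refine ⟨fun h n => h.trans_lt (lt_add_of_pos_right _ Nat.one_div_pos_of_nat), fun h => ?_⟩
      by_contra! hlt
      obtain ⟨n, hn⟩ := exists_nat_one_div_lt (sub_pos.2 hlt)
      linarith [h n]
    have hanti : Antitone fun n : ℕ => E ∩ Metric.ball (0 : Y) (t₀ + 1 / ((n : ℝ) + 1)) :=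
      fun m n hmn => inter_subset_inter_right _ (Metric.ball_subset_ball
        (add_le_add_right (Nat.one_div_le_one_div hmn) _))
    rw [h1, hI, hanti.measure_iInter
      (fun n => (hE.inter measurableSet_ball).nullMeasurableSet)
      ⟨0, ne_top_of_le_ne_top hfin (measure_mono inter_subset_left)⟩]
    exact le_iInf fun n => hup _ (lt_add_of_pos_right _ Nat.one_div_pos_of_nat)
  have hset : {y | y ∈ E ∧ μ (E ∩ Metric.ball 0 ‖y‖) < a} = E ∩ Metric.ball 0 t₀ := by
    ext y
    simp only [mem_ofPred_eq, mem_inter_iff, mem_ball_zero_iff]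
    refine and_congr_right fun _ => ⟨fun h => ?_, fun h => hlow _ h⟩
    by_contra! hlt
    exact (not_le.2 h) (hge.trans (hmono hlt))
  rw [hset]
  exact le_antisymm hle hge

/-- Measurable transfer of the distribution of a function, slice by slice, from a set to another
set whose slices have the same measure. -/
theorem exists_equimeasurable_transfer {Z : Type*} [MeasurableSpace Z] {E F : Set (Y × Z)}
    (hE : MeasurableSet E) (hF : MeasurableSet F)
    (hEF : ∀ z, μ {y | (y, z) ∈ E} = μ {y | (y, z) ∈ F})
    (hfin : ∀ z, μ {y | (y, z) ∈ F} ≠ ∞) {f : Y × Z → ℝ} (hf : Measurable f) {M : ℝ} (hM : 0 ≤ M)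
    (hfM : ∀ p ∈ F, f p ≤ M) :
    ∃ g : Y × Z → ℝ, Measurable g ∧ (∀ p, 0 ≤ g p) ∧ (∀ p, g p ≤ M) ∧
      ∀ z, ∀ t : ℝ, 0 ≤ t →
        μ {y | (y, z) ∈ E ∧ t < g (y, z)} = μ {y | (y, z) ∈ F ∧ t < f (y, z)} := by
  set Γ : Y × Z → ℝ≥0∞ := fun p => μ ({y | (y, p.2) ∈ E} ∩ Metric.ball 0 ‖p.1‖) with hΓ
  set a : Z → ℝ → ℝ≥0∞ := fun z t => μ {y | (y, z) ∈ F ∧ t < f (y, z)} with ha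
  have hΓm : Measurable Γ := by
    have hs : MeasurableSet {q : (Y × Z) × Y | (q.2, q.1.2) ∈ E ∧ ‖q.2‖ < ‖q.1.1‖} := by
      refine MeasurableSet.inter ?_ ?_
      · exact (by fun_prop : Measurable fun q : (Y × Z) × Y => (q.2, q.1.2)) hE
      · exact measurableSet_lt (f := fun q : (Y × Z) × Y => ‖q.2‖) (g := fun q => ‖q.1.1‖)
          (by fun_prop) (by fun_prop)
    convert measurable_measure_prodMk_left (ν := μ) hs using 1
    ext p
    simp only [hΓ]
    congr 1
    ext y
    simp
  have ham : ∀ t, Measurable fun z => a z t := by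
    intro t
    have hs : MeasurableSet {p : Y × Z | p ∈ F ∧ t < f p} :=
      hF.inter (measurableSet_lt measurable_const hf)
    exact measurable_measure_prodMk_right hs
  have hanti : ∀ z, Antitone (a z) := fun z t t' htt' =>
    measure_mono fun y hy => ⟨hy.1, htt'.trans_lt hy.2⟩
  have hzero : ∀ z t, M ≤ t → a z t = 0 := fun z t ht => by
    have : {y | (y, z) ∈ F ∧ t < f (y, z)} = ∅ := by
      ext y
      simp only [mem_ofPred_eq, mem_empty_iff_false, iff_false, not_and, not_lt]
      exact fun h => (hfM _ h).trans ht
    simp [ha, this]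
  -- Right continuity in t is what turns a strict inequality Γ < a z t into a strict inequality t <
  -- g.
  have hright : ∀ z t, a z t = ⨆ n : ℕ, a z (t + 1 / ((n : ℝ) + 1)) := by
    intro z t
    have hU : {y | (y, z) ∈ F ∧ t < f (y, z)} =
        ⋃ n : ℕ, {y | (y, z) ∈ F ∧ t + 1 / ((n : ℝ) + 1) < f (y, z)} := by
      ext y
      simp only [mem_ofPred_eq, mem_iUnion]
      refine ⟨fun h => ?_, fun ⟨n, hn⟩ =>
        ⟨hn.1, (lt_add_of_pos_right _ Nat.one_div_pos_of_nat).trans hn.2⟩⟩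
      obtain ⟨n, hn⟩ := exists_nat_one_div_lt (sub_pos.2 h.2)
      exact ⟨n, h.1, by linarith⟩
    have hmonoU : Monotone fun n : ℕ => {y | (y, z) ∈ F ∧ t + 1 / ((n : ℝ) + 1) < f (y, z)} :=
      fun m n hmn y hy => ⟨hy.1, (add_le_add_right (Nat.one_div_le_one_div hmn) _).trans_lt hy.2⟩
    simp only [ha]
    rw [hU, hmonoU.measure_iUnion]
  -- g is the decreasing rearrangement of f along the sweep of E: {g > t} is where the swept measure
  -- is below a z t, so `measure_swept_lt` gives its measure within E. Where T is empty, `sSup`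
  -- returns 0, as wanted.
  set T : Y × Z → Set ℝ := fun p => {t | 0 ≤ t ∧ Γ p < a p.2 t} with hT
  have hTM : ∀ p, ∀ t ∈ T p, t ≤ M := fun p t ht => by
    by_contra! h
    have := ht.2
    rw [hzero _ _ h.le] at this
    exact not_lt_bot this
  have hTb : ∀ p, BddAbove (T p) := fun p => ⟨M, hTM p⟩
  set g : Y × Z → ℝ := fun p => sSup (T p) with hg
  have hg0 : ∀ p, 0 ≤ g p := fun p => Real.sSup_nonneg fun t ht => ht.1
  have hiff : ∀ p t, 0 ≤ t → (t < g p ↔ Γ p < a p.2 t) := by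
    intro p t ht
    constructor
    · intro hlt
      have hne : (T p).Nonempty := by
        by_contra hemp
        rw [not_nonempty_iff_eq_empty] at hemp
        simp only [hg, hemp, Real.sSup_empty] at hlt
        linarith
      obtain ⟨t', ht', hlt'⟩ := exists_lt_of_lt_csSup hne hlt
      exact ht'.2.trans_le (hanti _ hlt'.le)
    · intro hlt
      rw [hright] at hlt
      obtain ⟨n, hn⟩ := lt_iSup_iff.1 hlt
      have hpos : (0 : ℝ) < 1 / ((n : ℝ) + 1) := Nat.one_div_pos_of_nat
      exact (lt_add_of_pos_right t hpos).trans_le (le_csSup (hTb p) ⟨by positivity, hn⟩)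
  refine ⟨g, measurable_of_Ioi fun t => ?_, hg0, fun p => Real.sSup_le (hTM p) hM, ?_⟩
  · rcases lt_or_ge t 0 with ht | ht
    · convert MeasurableSet.univ
      ext p
      simpa using ht.trans_le (hg0 p)
    · have : g ⁻¹' Ioi t = {p | Γ p < a p.2 t} := by
        ext p
        exact hiff p t ht
      rw [this]
      exact measurableSet_lt hΓm ((ham t).comp measurable_snd)
  · intro z t ht
    simp only [hiff _ t ht]
    have hEz : MeasurableSet {y | (y, z) ∈ E} :=
      (by fun_prop : Measurable fun y : Y => (y, z)) hE
    refine measure_swept_lt μ hEz (by rw [hEF]; exact hfin z) ?_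
    rw [hEF]
    exact measure_mono fun y hy => hy.1

end Transfer

/-! ### Slices of ℝⁿ and modification of kernels -/

namespace FracHessian

/-- The index equivalence behind `joinCoords`. -/
def indexSplit {n k : ℕ} (h : k ≤ n) : Fin k ⊕ Fin (n - k) ≃ Fin n :=
  finSumFinEquiv.trans (finCongr (by omega))

/-- `joinCoords` as a linear isometry from the Euclidean product. -/
noncomputable def joinIsometry {n k : ℕ} (h : k ≤ n) :
    WithLp 2 (EuclideanSpace ℝ (Fin k) × EuclideanSpace ℝ (Fin (n - k))) ≃ₗᵢ[ℝ]
      EuclideanSpace ℝ (Fin n) :=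
  (PiLp.sumPiLpEquivProdLpPiLp 2 (fun _ : Fin k ⊕ Fin (n - k) => ℝ)).symm.trans
    (LinearIsometryEquiv.piLpCongrLeft 2 ℝ ℝ (indexSplit h))

theorem joinIsometry_apply {n k : ℕ} (h : k ≤ n) (y : EuclideanSpace ℝ (Fin k))
    (z : EuclideanSpace ℝ (Fin (n - k))) :
    joinIsometry h (WithLp.toLp 2 (y, z)) = joinCoords n k y z := by
  ext i
  obtain ⟨j, rfl⟩ := (indexSplit h).surjective i
  rcases j with j | j
  · simp [joinIsometry, joinCoords, indexSplit, LinearIsometryEquiv.piLpCongrLeft_apply,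
      Equiv.piCongrLeft'_apply]
  · simp [joinIsometry, joinCoords, indexSplit, LinearIsometryEquiv.piLpCongrLeft_apply,
      Equiv.piCongrLeft'_apply]

/-- `joinCoords` as a measurable equivalence. -/
noncomputable def joinEquiv {n k : ℕ} (h : k ≤ n) :
    EuclideanSpace ℝ (Fin k) × EuclideanSpace ℝ (Fin (n - k)) ≃ᵐ EuclideanSpace ℝ (Fin n) :=
  (MeasurableEquiv.toLp 2 _).trans (joinIsometry h).toMeasurableEquiv

theorem joinEquiv_apply {n k : ℕ} (h : k ≤ n) (y : EuclideanSpace ℝ (Fin k))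
    (z : EuclideanSpace ℝ (Fin (n - k))) : joinEquiv h (y, z) = joinCoords n k y z :=
  joinIsometry_apply h y z

theorem measurePreserving_joinEquiv {n k : ℕ} (h : k ≤ n) :
    MeasurePreserving (joinEquiv h) :=
  (WithLp.volume_preserving_toLp _ _).trans (LinearIsometryEquiv.measurePreserving _)

theorem norm_joinCoords_sq {n k : ℕ} (h : k ≤ n) (y : EuclideanSpace ℝ (Fin k))
    (z : EuclideanSpace ℝ (Fin (n - k))) : ‖joinCoords n k y z‖ ^ 2 = ‖y‖ ^ 2 + ‖z‖ ^ 2 := by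
  rw [← joinIsometry_apply h, LinearIsometryEquiv.norm_map, WithLp.prod_norm_sq_eq_of_L2]
  rfl

/-- The slices of a ball of `ℝⁿ`. -/
theorem setOf_norm_joinCoords_lt {n k : ℕ} (h : k ≤ n) (z : EuclideanSpace ℝ (Fin (n - k)))
    {r : ℝ} (hr : 0 < r) :
    {y : EuclideanSpace ℝ (Fin k) | ‖joinCoords n k y z‖ < r} =
      if ‖z‖ < r then Metric.ball 0 (Real.sqrt (r ^ 2 - ‖z‖ ^ 2)) else ∅ := by
  ext y
  have h1 : ‖joinCoords n k y z‖ < r ↔ ‖y‖ ^ 2 < r ^ 2 - ‖z‖ ^ 2 := by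
    rw [← sq_lt_sq₀ (norm_nonneg _) hr.le, norm_joinCoords_sq h, lt_sub_iff_add_lt]
  rw [mem_ofPred_eq, h1]
  split_ifs with hz
  · rw [mem_ball_zero_iff, Real.lt_sqrt (norm_nonneg _)]
  · simp only [mem_empty_iff_false, iff_false, not_lt]
    have : r ^ 2 ≤ ‖z‖ ^ 2 := by gcongr; exact not_lt.1 hz
    nlinarith [sq_nonneg ‖y‖]

/-- The defining condition on kernels, in terms of the slices of balls of `ℝⁿ`. -/
theorem mem_kernels_iff {n k : ℕ} (h : k ≤ n) {s : ℝ} {K : EuclideanSpace ℝ (Fin n) → ℝ} :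
    K ∈ kernels n k s ↔ Measurable K ∧ (∀ x, 0 ≤ K x) ∧
      ∀ (z : EuclideanSpace ℝ (Fin (n - k))) (r : ℝ), 0 < r →
        volume {y : EuclideanSpace ℝ (Fin k) | r ^ (-(n : ℝ) - 2 * s) < K (joinCoords n k y z)} =
          volume {y : EuclideanSpace ℝ (Fin k) | ‖joinCoords n k y z‖ < r} := by
  refine and_congr_right fun _ => and_congr_right fun _ => forall_congr' fun z =>
    forall_congr' fun r => forall_congr' fun hr => ?_
  rw [setOf_norm_joinCoords_lt h z hr]
  split_ifs <;> simp

theorem measurable_joinCoords_left {n k : ℕ} (h : k ≤ n) (z : EuclideanSpace ℝ (Fin (n - k))) :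
    Measurable fun y : EuclideanSpace ℝ (Fin k) => joinCoords n k y z := by
  simp_rw [← joinEquiv_apply h]
  exact (joinEquiv h).measurable.comp measurable_prodMk_right

theorem volume_setOf_norm_joinCoords_lt_ne_top {n k : ℕ} (h : k ≤ n)
    (z : EuclideanSpace ℝ (Fin (n - k))) {r : ℝ} (hr : 0 < r) :
    volume {y : EuclideanSpace ℝ (Fin k) | ‖joinCoords n k y z‖ < r} ≠ ∞ := by
  rw [setOf_norm_joinCoords_lt h z hr]
  split_ifs
  · exact measure_ball_lt_top.ne
  · simp

/-- An admissible kernel can be replaced by an admissible kernel which is the fractional Laplace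
kernel in `B_ρ` and which, outside `B_ρ`, lies below the original kernel and below its truncation
at the height `ρ^(-n-2s)`. -/
theorem exists_kernel_eq_rpow_on_ball {n k : ℕ} (hk : 1 ≤ k) (hkn : k ≤ n) {s : ℝ} (hs : 0 < s)
    {K : EuclideanSpace ℝ (Fin n) → ℝ} (hK : K ∈ kernels n k s) {ρ : ℝ} (hρ : 0 < ρ) :
    ∃ K' ∈ kernels n k s, (∀ x, ‖x‖ < ρ → K' x = ‖x‖ ^ (-(n : ℝ) - 2 * s)) ∧
      ∀ x, ρ ≤ ‖x‖ → K' x ≤ min (K x) (ρ ^ (-(n : ℝ) - 2 * s)) := by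
  rw [mem_kernels_iff hkn] at hK
  obtain ⟨hKm, hK0, hKs⟩ := hK
  have : Nonempty (Fin k) := ⟨⟨0, hk⟩⟩
  set p : ℝ := -(n : ℝ) - 2 * s with hp
  have hpneg : p < 0 := by
    have : (0 : ℝ) ≤ n := n.cast_nonneg
    linarith
  set M : ℝ := ρ ^ p with hM
  have hM0 : 0 ≤ M := Real.rpow_nonneg hρ.le _
  have hJ := (joinEquiv hkn).measurable
  have hJz := measurable_joinCoords_left hkn
  set A : EuclideanSpace ℝ (Fin (n - k)) → Set (EuclideanSpace ℝ (Fin k)) :=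
    fun z => {y | ‖joinCoords n k y z‖ < ρ} with hA
  set B : EuclideanSpace ℝ (Fin (n - k)) → Set (EuclideanSpace ℝ (Fin k)) :=
    fun z => {y | M < K (joinCoords n k y z)} with hB
  have hAm : ∀ z, MeasurableSet (A z) := fun z => measurableSet_lt (hJz z).norm measurable_const
  have hBm : ∀ z, MeasurableSet (B z) := fun z =>
    measurableSet_lt measurable_const (hKm.comp (hJz z))
  have hAfin : ∀ z, volume (A z) ≠ ∞ := fun z => volume_setOf_norm_joinCoords_lt_ne_top hkn z hρ
  have hBA : ∀ z, volume (B z) = volume (A z) := fun z => hKs z ρ hρ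
  -- Installing |x|^p in the ball discards the values of K on F, all at most M; they are rehoused on
  -- E, where K exceeds M outside the ball.
  set E : Set (EuclideanSpace ℝ (Fin k) × EuclideanSpace ℝ (Fin (n - k))) :=
    {q | M < K (joinEquiv hkn q) ∧ ρ ≤ ‖joinEquiv hkn q‖} with hE
  set F : Set (EuclideanSpace ℝ (Fin k) × EuclideanSpace ℝ (Fin (n - k))) :=
    {q | ‖joinEquiv hkn q‖ < ρ ∧ K (joinEquiv hkn q) ≤ M} with hF
  have hEz : ∀ z, {y | (y, z) ∈ E} = B z \ A z := fun z => by
    ext y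
    simp [hE, hA, hB, joinEquiv_apply]
  have hFz : ∀ z, {y | (y, z) ∈ F} = A z \ B z := fun z => by
    ext y
    simp [hF, hA, hB, joinEquiv_apply]
  obtain ⟨g, hgm, hg0, hgM, hg⟩ := exists_equimeasurable_transfer
    (volume : Measure (EuclideanSpace ℝ (Fin k))) (E := E) (F := F)
    ((measurableSet_lt measurable_const (hKm.comp hJ)).inter
      (measurableSet_le measurable_const hJ.norm))
    ((measurableSet_lt hJ.norm measurable_const).inter
      (measurableSet_le (hKm.comp hJ) measurable_const))
    -- Cancel the common part A ∩ B, of finite measure, from two sets of equal measure.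
    (fun z => by
      rw [hEz, hFz]
      have h1 := measure_sdiff_add_inter (μ := volume) (B z) (hAm z)
      have h2 := measure_sdiff_add_inter (μ := volume) (A z) (hBm z)
      rw [hBA, ← h2, inter_comm] at h1
      exact (ENNReal.add_left_inj
        (ne_top_of_le_ne_top (hAfin z) (measure_mono inter_subset_left))).1 h1)
    (fun z => by
      rw [hFz]
      exact ne_top_of_le_ne_top (hAfin z) (measure_mono sdiff_subset))
    (hKm.comp hJ) hM0 (fun q hq => hq.2)
  -- At the origin `‖x‖ ^ p` evaluates to 0, so level sets can be wrong at that one point; it is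
  -- null in its slice since k ≥ 1.
  set K' : EuclideanSpace ℝ (Fin n) → ℝ := fun x =>
    if ‖x‖ < ρ then ‖x‖ ^ p else if M < K x then g ((joinEquiv hkn).symm x) else K x with hK'
  have hin : ∀ x, ‖x‖ < ρ → K' x = ‖x‖ ^ p := fun x hx => if_pos hx
  have hout : ∀ x, ρ ≤ ‖x‖ → M < K x → K' x = g ((joinEquiv hkn).symm x) := fun x hx hx' => by
    simp only [hK', if_neg (not_lt.2 hx), if_pos hx']
  have hout' : ∀ x, ρ ≤ ‖x‖ → K x ≤ M → K' x = K x := fun x hx hx' => by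
    simp only [hK', if_neg (not_lt.2 hx), if_neg (not_lt.2 hx')]
  have hmin : ∀ x, ρ ≤ ‖x‖ → K' x ≤ min (K x) M := fun x hx => by
    rcases lt_or_ge M (K x) with h | h
    · rw [hout x hx h]
      exact le_min ((hgM _).trans h.le) (hgM _)
    · rw [hout' x hx h]
      exact le_min le_rfl h
  have hK'm : Measurable K' :=
    Measurable.ite (measurableSet_lt measurable_norm measurable_const)
      (measurable_norm.pow_const p)
      (Measurable.ite (measurableSet_lt measurable_const hKm)
        (hgm.comp (joinEquiv hkn).symm.measurable) hKm)
  refine ⟨K', (mem_kernels_iff hkn).2 ⟨hK'm, fun x => ?_, fun z r hr => ?_⟩, hin, hmin⟩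
  · simp only [hK']
    split_ifs
    · positivity
    · exact hg0 _
    · exact hK0 x
  -- off the origin of the slice, the kernel inside `B_ρ` has the right level sets
  have hae : ∀ᵐ y : EuclideanSpace ℝ (Fin k), 0 < ‖joinCoords n k y z‖ := by
    have h0 : ∀ᵐ y : EuclideanSpace ℝ (Fin k), y ≠ 0 := by
      simp [ae_iff]
    filter_upwards [h0] with y hy
    have h1 := norm_joinCoords_sq hkn y z
    have h2 : 0 < ‖y‖ := norm_pos_iff.2 hy
    have h3 : 0 < ‖joinCoords n k y z‖ ^ 2 := by rw [h1]; positivity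
    refine norm_pos_iff.2 fun h4 => ?_
    rw [h4] at h3
    simp at h3
  have hinside : ∀ x : EuclideanSpace ℝ (Fin n), 0 < ‖x‖ → ‖x‖ < ρ → (r ^ p < K' x ↔ ‖x‖ < r) :=
    fun x hx hx' => by
      rw [hin x hx']
      exact Real.rpow_lt_rpow_iff_of_neg hr hx hpneg
  rcases le_or_gt r ρ with hrρ | hrρ
  · refine measure_congr ?_
    filter_upwards [hae] with y hy
    refine propext ?_
    change r ^ p < K' _ ↔ ‖joinCoords n k y z‖ < r
    rcases lt_or_ge ‖joinCoords n k y z‖ ρ with h | h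
    · exact hinside _ hy h
    · have h1 : K' (joinCoords n k y z) ≤ r ^ p := (hmin _ h).trans ((min_le_right _ _).trans
        (Real.rpow_le_rpow_of_nonpos hr hrρ hpneg.le))
      exact iff_of_false (not_lt.2 h1) (not_lt.2 (hrρ.trans h))
  -- Below height M, the ball replaces B, the part over E replaces the part of W displaced from A,
  -- and nothing else changes.
  · have hlt : r ^ p < M := Real.rpow_lt_rpow_of_neg hρ hrρ hpneg
    rw [← hKs z r hr]
    set V : Set (EuclideanSpace ℝ (Fin k)) := {y | r ^ p < K' (joinCoords n k y z)} with hV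
    set W : Set (EuclideanSpace ℝ (Fin k)) := {y | r ^ p < K (joinCoords n k y z)} with hW
    have e1 : volume (V ∩ A z) = volume (A z) := by
      refine measure_congr ?_
      filter_upwards [hae] with y hy
      refine propext ⟨fun h => h.2, fun h => ⟨?_, h⟩⟩
      exact (hinside _ hy h).2 (lt_trans h hrρ)
    have e2 : volume ((V \ A z) ∩ B z) = volume ((W \ B z) ∩ A z) := by
      have h1 : (V \ A z) ∩ B z = {y | (y, z) ∈ E ∧ r ^ p < g (y, z)} := by
        ext y
        simp only [hV, hA, hB, hE, mem_inter_iff, Set.mem_sdiff, mem_ofPred_eq, joinEquiv_apply, not_lt]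
        have hs : (joinEquiv hkn).symm (joinCoords n k y z) = (y, z) := by
          rw [← joinEquiv_apply hkn, MeasurableEquiv.symm_apply_apply]
        constructor
        · rintro ⟨⟨a, b⟩, c⟩
          rw [hout _ b c, hs] at a
          exact ⟨⟨c, b⟩, a⟩
        · rintro ⟨⟨c, b⟩, a⟩
          refine ⟨⟨?_, b⟩, c⟩
          rwa [hout _ b c, hs]
      have h2 : (W \ B z) ∩ A z = {y | (y, z) ∈ F ∧ r ^ p < (K ∘ joinEquiv hkn) (y, z)} := by
        ext y
        simp only [hW, hA, hB, hF, mem_inter_iff, Set.mem_sdiff, mem_ofPred_eq, joinEquiv_apply, not_lt,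
          Function.comp_apply]
        tauto
      rw [h1, h2]
      exact hg z _ (Real.rpow_nonneg hr.le _)
    have e3 : (V \ A z) \ B z = (W \ B z) \ A z := by
      ext y
      simp only [hV, hW, hA, hB, Set.mem_sdiff, mem_ofPred_eq, not_lt]
      constructor
      · rintro ⟨⟨a, b⟩, c⟩
        rw [hout' _ b c] at a
        exact ⟨⟨a, c⟩, b⟩
      · rintro ⟨⟨a, c⟩, b⟩
        refine ⟨⟨?_, b⟩, c⟩
        rwa [hout' _ b c]
    have e4 : W ∩ B z = B z := inter_eq_right.2 fun y hy => hlt.trans hy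
    rw [← measure_inter_add_sdiff V (hAm z), ← measure_inter_add_sdiff (V \ A z) (hBm z), e1, e2, e3,
      measure_inter_add_sdiff (W \ B z) (hAm z), ← hBA, ← measure_inter_add_sdiff W (hBm z), e4]

end FracHessian

/-! ### Integrals of powers and of truncated kernels -/

theorem lintegral_rpow_Ioo {q : ℝ} (hq : -1 < q) {M : ℝ} (hM : 0 ≤ M) :
    ∫⁻ t in Ioo 0 M, ENNReal.ofReal (t ^ q) = ENNReal.ofReal (M ^ (q + 1) / (q + 1)) := by
  have hint : IntegrableOn (fun t : ℝ => t ^ q) (Ioo 0 M) := by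
    have := intervalIntegral.intervalIntegrable_rpow' (a := 0) (b := M) hq
    rw [intervalIntegrable_iff_integrableOn_Ioo_of_le hM] at this
    exact this
  rw [← ofReal_integral_eq_lintegral_ofReal hint]
  · rw [← integral_Ioc_eq_integral_Ioo, ← intervalIntegral.integral_of_le hM,
      integral_rpow (Or.inl hq), Real.zero_rpow (by linarith), sub_zero]
  · exact (ae_restrict_mem measurableSet_Ioo).mono fun t ht => Real.rpow_nonneg ht.1.le _

/-- The integral of a negative power of the norm over a ball centred at the origin. -/
theorem lintegral_ball_norm_rpow {E : Type*} [NormedAddCommGroup E] [NormedSpace ℝ E]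
    [FiniteDimensional ℝ E] [Nontrivial E] [MeasurableSpace E] [BorelSpace E] (μ : Measure E)
    [μ.IsAddHaarMeasure] {a : ℝ} (ha : 0 < Module.finrank ℝ E + a) {ρ : ℝ} (hρ : 0 ≤ ρ) :
    ∫⁻ x in Metric.ball (0 : E) ρ, ENNReal.ofReal (‖x‖ ^ a) ∂μ =
      ENNReal.ofReal (Module.finrank ℝ E * μ.real (Metric.ball 0 1) *
        (ρ ^ (Module.finrank ℝ E + a) / (Module.finrank ℝ E + a))) := by
  set d := Module.finrank ℝ E with hd
  have hd1 : 1 ≤ d := Module.finrank_pos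
  have hexp : ∀ y ∈ Ioo (0 : ℝ) ρ, y ^ (d - 1) • y ^ a = y ^ ((d : ℝ) + a - 1) := by
    intro y hy
    rw [smul_eq_mul, ← Real.rpow_natCast, ← Real.rpow_add hy.1, Nat.cast_sub hd1]
    congr 1
    push_cast
    ring
  have hq : -1 < (d : ℝ) + a - 1 := by linarith
  have hint1 : IntegrableOn (fun y : ℝ => y ^ ((d : ℝ) + a - 1)) (Ioo 0 ρ) := by
    have := intervalIntegral.intervalIntegrable_rpow' (a := 0) (b := ρ) hq
    rwa [intervalIntegrable_iff_integrableOn_Ioo_of_le hρ] at this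
  have hint : IntegrableOn (fun x : E => ‖x‖ ^ a) (Metric.ball 0 ρ) μ := by
    rw [integrableOn_fun_norm_addHaar μ (f := fun y => y ^ a)]
    exact hint1.congr_fun (fun y hy => (hexp y hy).symm) measurableSet_Ioo
  rw [← ofReal_integral_eq_lintegral_ofReal hint (ae_of_all _ fun x => by positivity)]
  congr 1
  have h1 : ∫ x in Metric.ball (0 : E) ρ, ‖x‖ ^ a ∂μ =
      ∫ x, (Iio ρ).indicator (fun y : ℝ => y ^ a) ‖x‖ ∂μ := by
    rw [← integral_indicator measurableSet_ball]
    congr 1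
    ext x
    simp [indicator]
  have h2 : ∫ y in Ioi (0 : ℝ), y ^ (d - 1) • (Iio ρ).indicator (fun y : ℝ => y ^ a) y =
      ∫ y in Ioo 0 ρ, y ^ ((d : ℝ) + a - 1) := by
    rw [← setIntegral_congr_fun measurableSet_Ioo hexp, ← Ioi_inter_Iio,
      ← setIntegral_indicator measurableSet_Iio]
    congr 1
    ext y
    by_cases hy : y < ρ <;> simp [indicator, hy]
  rw [h1, integral_fun_norm_addHaar, ← hd, h2, ← integral_Ioc_eq_integral_Ioo,
    ← intervalIntegral.integral_of_le hρ, integral_rpow (Or.inl hq), Real.zero_rpow (by linarith)]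
  simp only [nsmul_eq_mul, smul_eq_mul, sub_zero, sub_add_cancel]
  ring

namespace FracHessian

/-- Tonelli over z: slicewise equality of measures integrates to equality in ℝⁿ, so only the
distribution of K matters for its truncated mass. -/
theorem volume_lt_kernel {n k : ℕ} (hkn : k ≤ n) {s : ℝ} {K : EuclideanSpace ℝ (Fin n) → ℝ}
    (hK : K ∈ kernels n k s) {r : ℝ} (hr : 0 < r) :
    volume {x | r ^ (-(n : ℝ) - 2 * s) < K x} =
      volume (Metric.ball (0 : EuclideanSpace ℝ (Fin n)) r) := by
  obtain ⟨hKm, -, hKs⟩ := (mem_kernels_iff hkn).1 hK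
  have hJ := measurePreserving_joinEquiv hkn
  have h1 : MeasurableSet {x | r ^ (-(n : ℝ) - 2 * s) < K x} :=
    measurableSet_lt measurable_const hKm
  have h2 : MeasurableSet (Metric.ball (0 : EuclideanSpace ℝ (Fin n)) r) := measurableSet_ball
  rw [← hJ.measure_preimage h1.nullMeasurableSet, ← hJ.measure_preimage h2.nullMeasurableSet,
    Measure.volume_eq_prod, Measure.prod_apply_symm (hJ.measurable h1),
    Measure.prod_apply_symm (hJ.measurable h2)]
  refine lintegral_congr fun z => ?_
  convert hKs z r hr using 2
  · ext y
    simp [joinEquiv_apply]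
  · ext y
    simp [joinEquiv_apply]

/-- The integral of the truncation of an admissible kernel at the height `ρ^(-n-2s)`. -/
theorem lintegral_min_kernel_le {n k : ℕ} (hkn : k ≤ n) {s : ℝ} (hs : 0 < s)
    {K : EuclideanSpace ℝ (Fin n) → ℝ} (hK : K ∈ kernels n k s) {ρ : ℝ} (hρ : 0 < ρ) :
    ∫⁻ x, ENNReal.ofReal (min (K x) (ρ ^ (-(n : ℝ) - 2 * s))) ≤
      ENNReal.ofReal (volume.real (Metric.ball (0 : EuclideanSpace ℝ (Fin n)) 1) *
        ((n + 2 * s) / (2 * s)) * ρ ^ (-2 * s)) := by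
  obtain ⟨hKm, hK0, -⟩ := (mem_kernels_iff hkn).1 hK
  set p : ℝ := -(n : ℝ) - 2 * s with hp
  have hn : (0 : ℝ) ≤ n := n.cast_nonneg
  have hpneg : p < 0 := by linarith
  set M : ℝ := ρ ^ p with hM
  have hM0 : 0 < M := Real.rpow_pos_of_pos hρ _
  set ω : ℝ := volume.real (Metric.ball (0 : EuclideanSpace ℝ (Fin n)) 1) with hω
  have hω0 : 0 ≤ ω := measureReal_nonneg
  have hq : -1 < (n : ℝ) / p := by
    rw [lt_div_iff_of_neg hpneg]
    linarith
  -- Layer cake: the level t = r^p has measure ω rⁿ = ω t^(n/p), integrable at 0 because n < n + 2s.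
  have hlevel : ∀ t ∈ Ioi (0 : ℝ), volume {x | t < min (K x) M} ≤
      (Ioo 0 M).indicator (fun t => ENNReal.ofReal ω * ENNReal.ofReal (t ^ ((n : ℝ) / p))) t := by
    intro t ht
    have ht : 0 < t := ht
    rcases lt_or_ge t M with htM | htM
    · rw [indicator_of_mem (show t ∈ Ioo 0 M from ⟨ht, htM⟩)]
      set r := t ^ (1 / p) with hr
      have hr0 : 0 < r := Real.rpow_pos_of_pos ht _
      have hrp : r ^ p = t := by
        rw [hr, ← Real.rpow_mul ht.le, one_div_mul_cancel hpneg.ne, Real.rpow_one]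
      have h1 : volume {x | t < min (K x) M} ≤ volume {x | r ^ p < K x} :=
        measure_mono fun x (hx : t < min (K x) M) => by
          change r ^ p < K x
          rw [hrp]
          exact (lt_min_iff.1 hx).1
      refine h1.trans (le_of_eq ?_)
      rw [volume_lt_kernel hkn hK hr0, Measure.addHaar_ball_of_pos _ _ hr0, finrank_euclideanSpace_fin,
        mul_comm, hω, ofReal_measureReal]
      congr 2
      rw [hr, ← Real.rpow_natCast, ← Real.rpow_mul ht.le]
      congr 1
      ring
    · have : {x | t < min (K x) M} = ∅ := by
        ext x
        simp only [mem_ofPred_eq, mem_empty_iff_false, iff_false, not_lt]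
        exact (min_le_right _ _).trans htM
      rw [this, measure_empty]
      exact zero_le
  rw [lintegral_eq_lintegral_meas_lt volume (ae_of_all _ fun x => le_min (hK0 x) hM0.le)
    (hKm.min measurable_const).aemeasurable]
  refine (setLIntegral_mono' measurableSet_Ioi hlevel).trans (le_of_eq ?_)
  rw [setLIntegral_indicator measurableSet_Ioo, inter_eq_left.2 Ioo_subset_Ioi_self,
    lintegral_const_mul' _ _ ENNReal.ofReal_ne_top, lintegral_rpow_Ioo hq hM0.le,
    ← ENNReal.ofReal_mul hω0]
  congr 1
  have e1 : (n : ℝ) / p + 1 = 2 * s / (n + 2 * s) := by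
    have : (n : ℝ) + 2 * s ≠ 0 := by positivity
    rw [hp]
    have h2 : -(n : ℝ) - 2 * s ≠ 0 := hpneg.ne
    field_simp
    ring
  have e2 : M ^ ((n : ℝ) / p + 1) = ρ ^ (-2 * s) := by
    rw [hM, ← Real.rpow_mul hρ.le]
    congr 1
    rw [mul_add, mul_div_cancel₀ _ hpneg.ne, hp]
    ring
  rw [e2, e1]
  field_simp

end FracHessian

/-! ### Extended reals and comparison of the integrals -/

/-- The embedding is monotone and continuous; preserving ⊤ covers the empty index type, as in an
infimum over a false membership. -/
theorem EReal.coe_ennreal_iInf {ι : Sort*} (f : ι → ℝ≥0∞) :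
    ((⨅ i, f i : ℝ≥0∞) : EReal) = ⨅ i, (f i : EReal) :=
  Monotone.map_iInf_of_continuousAt continuous_coe_ennreal_ereal.continuousAt
    EReal.coe_ennreal_strictMono.monotone EReal.coe_ennreal_top

namespace FracHessian

theorem fracLapConst_pos (n : ℕ) {s : ℝ} (hs : s ∈ Ioo (0 : ℝ) 1) : 0 < fracLapConst n s := by
  have h1 : 0 < Real.Gamma ((n : ℝ) / 2 + s) :=
    Real.Gamma_pos_of_pos (add_pos_of_nonneg_of_pos (by positivity) hs.1)
  have h2 : 0 < Real.Gamma (1 - s) := Real.Gamma_pos_of_pos (by linarith [hs.2])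
  have h3 := hs.1
  unfold fracLapConst
  positivity

/-- For convex `u`, the operator takes values in `[0, ∞]`. -/
theorem operatorF_eq {n k : ℕ} {s : ℝ} (hs : s ∈ Ioo (0 : ℝ) 1) {u : EuclideanSpace ℝ (Fin n) → ℝ}
    (hc : ConvexOn ℝ univ u) (hu : c11Seminorm u ≤ 1) (x₀ : EuclideanSpace ℝ (Fin n)) :
    operatorF n k s u x₀ =
      ((ENNReal.ofReal (fracLapConst n s) *
        ⨅ K ∈ kernels n k s, ∫⁻ x, ENNReal.ofReal (tilde u x₀ x * K x) : ℝ≥0∞) : EReal) := by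
  have h1 : ∀ K ∈ kernels n k s, eIntegral (fun x => tilde u x₀ x * K x) =
      ((∫⁻ x, ENNReal.ofReal (tilde u x₀ x * K x) : ℝ≥0∞) : EReal) := fun K hK => by
    have h2 : ∀ x, ENNReal.ofReal (-(tilde u x₀ x * K x)) = 0 := fun x =>
      ENNReal.ofReal_of_nonpos (neg_nonpos.2 (mul_nonneg (tilde_nonneg hc hu x₀ x) (hK.2.1 x)))
    simp [eIntegral, h2]
  rw [operatorF, EReal.coe_ennreal_mul, EReal.coe_ennreal_ofReal,
    max_eq_left (fracLapConst_pos n hs).le, EReal.coe_ennreal_iInf]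
  congr 1
  refine iInf_congr fun K => ?_
  rw [EReal.coe_ennreal_iInf]
  exact iInf_congr fun hK => h1 K hK

/-- The integral, against a modified kernel, of the increment of `u` at a nearby point. -/
theorem exists_kernel_lintegral_le {n k : ℕ} (hk : 1 ≤ k) (hkn : k ≤ n) {s : ℝ}
    (hs : s ∈ Ioo (0 : ℝ) 1) {u : EuclideanSpace ℝ (Fin n) → ℝ}
    (hc : ConvexOn ℝ univ u) (hu : c11Seminorm u ≤ 1) {x₀ x₁ : EuclideanSpace ℝ (Fin n)}
    {Λ ε : ℝ} (hΛ : 0 < Λ) (hε : 0 < ε) (hne : x₁ ≠ x₀)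
    (hlin : ∀ x, ‖x‖ ≤ Λ + Λ / ε * tilde u x₀ x)
    {K : EuclideanSpace ℝ (Fin n) → ℝ} (hK : K ∈ kernels n k s) :
    ∃ K' ∈ kernels n k s, ∫⁻ x, ENNReal.ofReal (tilde u x₁ x * K' x) ≤
      ENNReal.ofReal (volume.real (Metric.ball (0 : EuclideanSpace ℝ (Fin n)) 1) *
        (n / (2 - 2 * s) + 4 * ((n + 2 * s) / (2 * s))) * (Λ ^ (1 - s) * ‖x₁ - x₀‖ ^ (1 - s))) +
      (1 + ENNReal.ofReal (4 * Λ / ε * ‖x₁ - x₀‖)) *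
        ∫⁻ x, ENNReal.ofReal (tilde u x₀ x * K x) := by
  obtain ⟨hs0, hs1⟩ := hs
  have : Nonempty (Fin n) := ⟨⟨0, by omega⟩⟩
  set d := ‖x₁ - x₀‖ with hd
  have hd0 : 0 < d := norm_pos_iff.2 (sub_ne_zero.2 hne)
  set ω : ℝ := volume.real (Metric.ball (0 : EuclideanSpace ℝ (Fin n)) 1) with hω
  have hω0 : 0 ≤ ω := measureReal_nonneg
  -- This radius equates the inner contribution ρ^(2-2s) with the outer one dΛ ρ^(-2s).
  set ρ : ℝ := (d * Λ) ^ (1 / 2 : ℝ) with hρdef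
  have hdΛ : 0 < d * Λ := mul_pos hd0 hΛ
  have hρ : 0 < ρ := Real.rpow_pos_of_pos hdΛ _
  obtain ⟨K', hK', hin, hout⟩ := exists_kernel_eq_rpow_on_ball hk hkn hs0 hK hρ
  refine ⟨K', hK', ?_⟩
  set p : ℝ := -(n : ℝ) - 2 * s with hp
  set T₀ := tilde u x₀ with hT₀
  have hT₀0 : ∀ x, 0 ≤ T₀ x := tilde_nonneg hc hu x₀
  have hT₁0 : ∀ x, 0 ≤ tilde u x₁ x := tilde_nonneg hc hu x₁
  have hT₀m : Measurable T₀ := measurable_tilde hu x₀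
  have hinner : ∫⁻ x in Metric.ball (0 : EuclideanSpace ℝ (Fin n)) ρ,
      ENNReal.ofReal (tilde u x₁ x * K' x) ≤
        ENNReal.ofReal (ω * (n / (2 - 2 * s)) * (d * Λ) ^ (1 - s)) := by
    have h1 : ∀ x ∈ Metric.ball (0 : EuclideanSpace ℝ (Fin n)) ρ,
        ENNReal.ofReal (tilde u x₁ x * K' x) ≤ ENNReal.ofReal (‖x‖ ^ (2 + p)) := by
      intro x hx
      rw [mem_ball_zero_iff] at hx
      refine ENNReal.ofReal_le_ofReal ?_
      rw [hin x hx]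
      refine (mul_le_mul_of_nonneg_right (tilde_le_norm_sq hu x₁ x)
        (Real.rpow_nonneg (norm_nonneg x) p)).trans ?_
      rcases (norm_nonneg x).eq_or_lt with h0 | h0
      · rw [← h0]
        simp [Real.rpow_nonneg]
      · rw [Real.rpow_add h0, Real.rpow_two]
    have hdim : 0 < (Module.finrank ℝ (EuclideanSpace ℝ (Fin n)) : ℝ) + (2 + p) := by
      rw [finrank_euclideanSpace_fin, hp]
      linarith
    refine (setLIntegral_mono' measurableSet_ball h1).trans (le_of_eq ?_)
    rw [lintegral_ball_norm_rpow volume hdim hρ.le, finrank_euclideanSpace_fin, ← hω]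
    have e : (n : ℝ) + (2 + p) = 2 - 2 * s := by rw [hp]; ring
    rw [e]
    have e2 : ρ ^ (2 - 2 * s) = (d * Λ) ^ (1 - s) := by
      rw [hρdef, ← Real.rpow_mul hdΛ.le]
      congr 1
      ring
    rw [e2]
    congr 1
    ring
  have houter : ∫⁻ x in (Metric.ball (0 : EuclideanSpace ℝ (Fin n)) ρ)ᶜ,
      ENNReal.ofReal (tilde u x₁ x * K' x) ≤
        ENNReal.ofReal (ω * (4 * ((n + 2 * s) / (2 * s))) * (d * Λ) ^ (1 - s)) +
          (1 + ENNReal.ofReal (4 * Λ / ε * d)) * ∫⁻ x, ENNReal.ofReal (T₀ x * K x) := by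
    have hθ : 0 ≤ 4 * Λ / ε * d := by positivity
    have h1 : ∀ x ∈ (Metric.ball (0 : EuclideanSpace ℝ (Fin n)) ρ)ᶜ,
        ENNReal.ofReal (tilde u x₁ x * K' x) ≤
          ENNReal.ofReal (4 * (d * Λ)) * ENNReal.ofReal (min (K x) (ρ ^ p)) +
            (1 + ENNReal.ofReal (4 * Λ / ε * d)) * ENNReal.ofReal (T₀ x * K x) := by
      intro x hx
      rw [mem_compl_iff, mem_ball_zero_iff, not_lt] at hx
      have hm0 : 0 ≤ min (K x) (ρ ^ p) := le_min (hK.2.1 x) (Real.rpow_nonneg hρ.le _)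
      have hTK : 0 ≤ T₀ x * K x := mul_nonneg (hT₀0 x) (hK.2.1 x)
      rw [← ENNReal.ofReal_one, ← ENNReal.ofReal_add zero_le_one hθ,
        ← ENNReal.ofReal_mul (by positivity), ← ENNReal.ofReal_mul (by positivity),
        ← ENNReal.ofReal_add (by positivity) (by positivity)]
      refine ENNReal.ofReal_le_ofReal ?_
      have h2 : tilde u x₁ x ≤ 4 * (d * Λ) + (1 + 4 * Λ / ε * d) * T₀ x := by
        have h3 := tilde_le_tilde_add hc hu x₀ x₁ x
        have h4 := mul_le_mul_of_nonneg_left (hlin x) (by positivity : 0 ≤ 4 * d)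
        have e : 4 * d * (Λ + Λ / ε * T₀ x) = 4 * (d * Λ) + 4 * Λ / ε * d * T₀ x := by ring
        linarith
      -- The truncation is kept on the constant term, where K itself may have infinite mass, and
      -- dropped on the ũ term.
      calc tilde u x₁ x * K' x ≤ tilde u x₁ x * min (K x) (ρ ^ p) :=
            mul_le_mul_of_nonneg_left (hout x hx) (hT₁0 x)
        _ ≤ (4 * (d * Λ) + (1 + 4 * Λ / ε * d) * T₀ x) * min (K x) (ρ ^ p) :=
            mul_le_mul_of_nonneg_right h2 hm0
        _ = 4 * (d * Λ) * min (K x) (ρ ^ p) +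
              (1 + 4 * Λ / ε * d) * T₀ x * min (K x) (ρ ^ p) := by ring
        _ ≤ 4 * (d * Λ) * min (K x) (ρ ^ p) + (1 + 4 * Λ / ε * d) * T₀ x * K x := by
            have : 0 ≤ (1 + 4 * Λ / ε * d) * T₀ x := mul_nonneg (by positivity) (hT₀0 x)
            gcongr
            exact min_le_left _ _
        _ = _ := by ring
    refine (setLIntegral_mono' measurableSet_ball.compl h1).trans
      ((setLIntegral_le_lintegral _ _).trans ?_)
    rw [lintegral_add_left (by have := hK.1; fun_prop),
      lintegral_const_mul' _ _ ENNReal.ofReal_ne_top,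
      lintegral_const_mul' _ _ (by simp)]
    refine add_le_add_left ?_ _
    refine (mul_le_mul_right (lintegral_min_kernel_le hkn hs0 hK hρ) _).trans (le_of_eq ?_)
    rw [← ENNReal.ofReal_mul (by positivity)]
    congr 1
    have e1 : ρ ^ (-2 * s) = (d * Λ) ^ (-s) := by
      rw [hρdef, ← Real.rpow_mul hdΛ.le]
      congr 1
      ring
    have e2 : (d * Λ) ^ (1 - s) = (d * Λ) * (d * Λ) ^ (-s) := by
      rw [sub_eq_add_neg, Real.rpow_add hdΛ, Real.rpow_one]
    rw [e1, e2]
    ring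
  rw [← lintegral_add_compl _ (measurableSet_ball (x := (0 : EuclideanSpace ℝ (Fin n))) (ε := ρ))]
  refine (add_le_add hinner houter).trans (le_of_eq ?_)
  have h2s : 0 < 2 - 2 * s := by linarith
  rw [← add_assoc, ← ENNReal.ofReal_add (by positivity) (by positivity),
    Real.mul_rpow hd0.le hΛ.le]
  congr 2
  ring

end FracHessian

theorem proposition5p2 (n k : ℕ) (hk : 1 ≤ k) (hkn : k < n) (s : ℝ) (hs : s ∈ Set.Ioo (1 / 2 : ℝ) 1) :
    ∃ C : ℝ, 0 < C ∧
      ∀ (u : EuclideanSpace ℝ (Fin n) → ℝ) (x₀ : EuclideanSpace ℝ (Fin n)) (ε Λ : ℝ),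
        ConvexOn ℝ Set.univ u →
        FracHessian.c11Seminorm u ≤ 1 →
        0 < ε →
        Bornology.IsBounded (FracHessian.sectionSet u x₀ ε) →
        Λ = Metric.diam (FracHessian.sectionSet u x₀ ε) →
        ∀ r : ℝ, r ≤ ε / (4 * Λ) →
          ∀ x₁ ∈ Metric.ball x₀ r,
            FracHessian.operatorF n k s u x₁ ≤
              FracHessian.operatorF n k s u x₀ +
                (((C * Λ ^ (1 - s) * ‖x₁ - x₀‖ ^ (1 - s) : ℝ) : EReal) +
                  ((4 * Λ / ε * ‖x₁ - x₀‖ : ℝ) : EReal) * FracHessian.operatorF n k s u x₀) := by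
  have hs' : s ∈ Ioo (0 : ℝ) 1 := ⟨by linarith [hs.1], hs.2⟩
  have hs0 : 0 < s := hs'.1
  have hs1 : 0 < 2 - 2 * s := by linarith [hs.2]
  have hc0 := FracHessian.fracLapConst_pos n hs'
  set c := FracHessian.fracLapConst n s
  have hω : 0 < volume.real (Metric.ball (0 : EuclideanSpace ℝ (Fin n)) 1) :=
    ENNReal.toReal_pos (Metric.measure_ball_pos _ _ one_pos).ne' measure_ball_lt_top.ne
  set A : ℝ := volume.real (Metric.ball (0 : EuclideanSpace ℝ (Fin n)) 1) *
    (n / (2 - 2 * s) + 4 * ((n + 2 * s) / (2 * s))) with hA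
  have hA0 : 0 < A := by positivity
  refine ⟨c * A, by positivity, ?_⟩
  intro u x₀ ε Λ hconv hu hε hb hΛeq r hr x₁ hx₁
  have hr0 : 0 < r := Metric.pos_of_mem_ball hx₁
  -- If Λ were 0, then ε / (4Λ) would be 0 by convention, and the ball containing x₁ would be empty.
  have hΛ : 0 < Λ := by
    have h1 : 0 < ε / (4 * Λ) := hr0.trans_le hr
    have h2 := (div_pos_iff_of_pos_left hε).1 h1
    linarith
  -- Coincident points would give ρ = 0; here both error terms vanish, since 0 · ∞ = 0.
  rcases eq_or_ne x₁ x₀ with rfl | hne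
  · have : 1 - s ≠ 0 := by linarith
    simp [Real.zero_rpow this]
  have hlin : ∀ x, ‖x‖ ≤ Λ + Λ / ε * FracHessian.tilde u x₀ x := by
    rw [hΛeq]
    exact FracHessian.norm_le_diam_add hconv hu hε hb
  set I : EuclideanSpace ℝ (Fin n) → ℝ≥0∞ := fun x' =>
    ⨅ K ∈ FracHessian.kernels n k s, ∫⁻ x, ENNReal.ofReal (FracHessian.tilde u x' x * K x) with hI
  set a : ℝ := A * (Λ ^ (1 - s) * ‖x₁ - x₀‖ ^ (1 - s)) with ha
  set θ : ℝ := 4 * Λ / ε * ‖x₁ - x₀‖ with hθ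
  have ha0 : 0 ≤ a := by positivity
  have hθ0 : 0 ≤ θ := by positivity
  have key : I x₁ ≤ ENNReal.ofReal a + (1 + ENNReal.ofReal θ) * I x₀ := by
    -- A finite nonzero factor commutes with infima in [0, ∞], so the bound for each K passes to the
    -- infimum.
    have h1 : (1 + ENNReal.ofReal θ) ≠ 0 := by simp
    have h2 : (1 + ENNReal.ofReal θ) ≠ ∞ := by simp
    simp only [hI]
    rw [ENNReal.mul_iInf_of_ne h1 h2, ENNReal.add_iInf]
    refine le_iInf fun K => ?_
    rw [ENNReal.mul_iInf_of_ne h1 h2, ENNReal.add_iInf]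
    refine le_iInf fun hK => ?_
    obtain ⟨K', hK', hle⟩ := FracHessian.exists_kernel_lintegral_le hk hkn.le hs' hconv hu hΛ hε
      hne hlin hK
    exact (iInf₂_le K' hK').trans hle
  have e1 : ((c * A * Λ ^ (1 - s) * ‖x₁ - x₀‖ ^ (1 - s) : ℝ) : EReal) =
      ((ENNReal.ofReal c * ENNReal.ofReal a : ℝ≥0∞) : EReal) := by
    rw [← ENNReal.ofReal_mul hc0.le, EReal.coe_ennreal_ofReal, max_eq_left (by positivity), ha]
    congr 1
    ring
  have e2 : (θ : EReal) = ((ENNReal.ofReal θ : ℝ≥0∞) : EReal) := by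
    rw [EReal.coe_ennreal_ofReal, max_eq_left hθ0]
  rw [FracHessian.operatorF_eq hs' hconv hu, FracHessian.operatorF_eq hs' hconv hu, e1, e2,
    ← EReal.coe_ennreal_mul, ← EReal.coe_ennreal_add, ← EReal.coe_ennreal_add,
    EReal.coe_ennreal_le_coe_ennreal_iff]
  refine (mul_le_mul_right key _).trans (le_of_eq ?_)
  simp only [hI]
  ring
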